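/- Let $G=(S,T,E)$ be a finite bipartite graph with vertex set $V=S\sqcup T$, and let every edge $e\in E$ have a weight $w(e)>0$. For a matching $M$ of $G$ put $w(M)=\prod_{e\in M}w(e)$, let $V(M)$ be the set of vertices covered by $M$, and let $B(M)=V(M)\,\Delta\,S$, where $\Delta$ denotes symmetric difference. For $\mathcal A,\mathcal B\subseteq 2^V$ let $$\mathcal A\,\square\,\mathcal B=\{A\cup B : A\in\mathcal A,\ B\in\mathcal B,\ A\cap B=\emptyset\}.$$ Let $M$ be a random matching of $G$ (the empty matching being allowed), where the probability of each matching is proportional to its weight. Then $B(M)$ satisfies the BK inequality for increasing events, that is, for all upward closed $\mathcal A,\mathcal B\subseteq 2^V$, $$\mathbb P\big(B(M)\in\mathcal A\,\square\,\mathcal B\big)\le \mathbb P\big(B(M)\in\mathcal A\big)\,\mathbb P\big(B(M)\in\mathcal B\big).$$ -/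

import Mathlib

namespace BKMatching

open scoped symmDiff

/-- The matchings of `G`: subgraphs in which every vertex has exactly one neighbour, so that the
vertex set of such a subgraph is the set of vertices covered by its edges. -/
abbrev Matching {V : Type*} (G : SimpleGraph V) : Type _ :=
  {M : G.Subgraph // M.IsMatching}

/-- The empty matching. -/
def emptyMatching {V : Type*} (G : SimpleGraph V) : Matching G :=
  ⟨⊥, fun _ hv => hv.elim⟩

/-- The weight of a matching: the product of the weights of its edges. -/
noncomputable def weight {V : Type*} [Finite V] {G : SimpleGraph V} (w : Sym2 V → ℝ)
    (M : Matching G) : ℝ :=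
  ∏ e ∈ (Set.toFinite M.1.edgeSet).toFinset, w e

theorem weight_emptyMatching {V : Type*} [Finite V] (G : SimpleGraph V) (w : Sym2 V → ℝ) :
    weight w (emptyMatching G) = 1 := by
  simp [weight, emptyMatching]

theorem tsum_weight_ne_zero {V : Type*} [Finite V] (G : SimpleGraph V) (w : Sym2 V → ℝ) :
    ∑' M : Matching G, ENNReal.ofReal (weight w M) ≠ 0 := by
  intro h
  have h0 := ENNReal.tsum_eq_zero.mp h (emptyMatching G)
  simp [weight_emptyMatching] at h0

theorem tsum_weight_ne_top {V : Type*} [Finite V] (G : SimpleGraph V) (w : Sym2 V → ℝ) :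
    ∑' M : Matching G, ENNReal.ofReal (weight w M) ≠ ⊤ := by
  have := Fintype.ofFinite (Matching G)
  rw [tsum_fintype]
  exact ENNReal.sum_ne_top.mpr fun _ _ => ENNReal.ofReal_ne_top

/-- The law of the random matching whose probabilities are proportional to the weights. -/
noncomputable def randomMatching {V : Type*} [Finite V] (G : SimpleGraph V) (w : Sym2 V → ℝ) :
    PMF (Matching G) :=
  PMF.normalize (fun M => ENNReal.ofReal (weight w M))
    (tsum_weight_ne_zero G w) (tsum_weight_ne_top G w)

/-- `B(M) = V(M) ∆ S`. -/
def coverSymmDiff {V : Type*} {G : SimpleGraph V} (S : Set V) (M : Matching G) : Set V :=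
  M.1.verts ∆ S

/-- The law of the random set `B(M)`, for the weighted random matching `M`. -/
noncomputable def randomSet {V : Type*} [Finite V] (G : SimpleGraph V) (S : Set V)
    (w : Sym2 V → ℝ) : PMF (Set V) :=
  (randomMatching G w).map (coverSymmDiff S)

/-- The probability that a random subset of `V` with law `μ` belongs to `𝒜`. -/
noncomputable def prob {V : Type*} (μ : PMF (Set V)) (𝒜 : Set (Set V)) : ENNReal :=
  @PMF.toMeasure (Set V) ⊤ μ 𝒜

/-- The disjoint occurrence `𝒜 □ ℬ` of two events. -/
def disjointOccurrence {V : Type*} (𝒜 ℬ : Set (Set V)) : Set (Set V) :=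
  {C | ∃ A ∈ 𝒜, ∃ B ∈ ℬ, A ∩ B = ∅ ∧ C = A ∪ B}

end BKMatching

/-!
Take two independent copies `M`, `N` of the random matching. Exchanging them on any set of
connected components of `M ∪ N` preserves the joint law, so it suffices to compare, for a fixed
pair, the numbers of exchanges that produce the two events. Direct the edges of `M` into `S` and
those of `N` out of `S`: every vertex has in-degree at most one, and the vertices of
`B(M) \ B(N)` are sources, so each component contains at most one of them, and likewise for
`B(N) \ B(M)`. Hence `B` of the exchanged matching acquires at most one vertex outside
`B(M) ∩ B(N)` from each component, disjoint subsets of it use disjoint sets of components, and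
the comparison of the numbers of exchanges is Reimer's theorem `|A □ B| ≤ |A ∩ -B|` on the cube
of exchanges, where `-B` consists of the antipodes of the points of `B`.
-/

namespace BKMatching

open MeasureTheory Matrix

section LinearAlgebra

variable {n R R₁ R₂ : Type*} [Fintype n] [DecidableEq n] [CommRing R] [IsDomain R]
  [CommRing R₁] [Nontrivial R₁] [CommRing R₂] [Nontrivial R₂]

theorem eq_zero_of_forall_eq_zero_or_vecMul_eq_zero (f : R →+* R₁) {P : Matrix n n R}
    (hP : P.map f = 1) {v : n → R} (hv : ∀ j, v j = 0 ∨ (v ᵥ* P) j = 0) : v = 0 := by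
  classical
  -- Replacing the columns of `P` where `v` vanishes by those of the identity keeps `P ≡ 1`.
  let Q : Matrix n n R := of fun i j => if v j = 0 then (1 : Matrix n n R) i j else P i j
  have hQ : Q.map f = 1 := by
    ext i j
    by_cases hj : v j = 0
    · simp [Q, hj, one_apply, apply_ite f]
    · simpa [Q, hj] using congrFun₂ hP i j
  have hdet : Q.det ≠ 0 := fun h => one_ne_zero (α := R₁) <| by
    rw [← det_one (n := n), ← hQ, ← RingHom.mapMatrix_apply, ← RingHom.map_det, h, map_zero]
  refine eq_zero_of_vecMul_eq_zero hdet (funext fun j => ?_)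
  by_cases hj : v j = 0
  · simp [vecMul, dotProduct, Q, hj, one_apply]
  · simpa [vecMul, dotProduct, Q, hj] using (hv j).resolve_left hj

theorem ncard_le_ncard_inter_of_map_eq_one (f : R →+* R₁) (g : R →+* R₂) {W P : Matrix n n R}
    (hW : W.map f = 1) (hP : P.map g = 1) {F A B : Set n}
    (hA : ∀ x ∈ F, ∀ y ∉ A, W x y = 0) (hB : ∀ x ∈ F, ∀ y ∉ B, (W * P) x y = 0) :
    F.ncard ≤ (A ∩ B).ncard := by
  classical
  let WF : Matrix F n R := W.submatrix Subtype.val id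
  have hWF : Function.Injective WF.vecMul := by
    refine vecMul_injective_iff.mpr ((vecMul_injective_iff (M := W)).mp ?_ |>.comp _
      Subtype.val_injective)
    refine (injective_iff_map_eq_zero W.vecMulLinear).mpr fun c hc => ?_
    exact eq_zero_of_forall_eq_zero_or_vecMul_eq_zero f hW fun j => .inr (congrFun hc j)
  have hvA (c : F → R) (y : n) (hy : y ∉ A) : (c ᵥ* WF) y = 0 :=
    Finset.sum_eq_zero fun x _ => by simp [WF, hA x x.2 y hy]
  have hvB (c : F → R) (y : n) (hy : y ∉ B) : (c ᵥ* WF ᵥ* P) y = 0 := by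
    rw [vecMul_vecMul]
    exact Finset.sum_eq_zero fun x _ => mul_eq_zero_of_right _ (hB x x.2 y hy)
  let φ : (F → R) →ₗ[R] (↑(A ∩ B) → R) := (WF.submatrix id Subtype.val).vecMulLinear
  have hφ : Function.Injective φ := by
    refine (injective_iff_map_eq_zero φ).mpr fun c hc => hWF (.trans ?_ (zero_vecMul WF).symm)
    refine eq_zero_of_forall_eq_zero_or_vecMul_eq_zero g hP fun y => ?_
    by_cases hyA : y ∈ A
    · by_cases hyB : y ∈ B
      · exact .inl (congrFun hc ⟨y, hyA, hyB⟩)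
      · exact .inr (hvB c y hyB)
    · exact .inl (hvA c y hyA)
  simpa only [Fintype.card_eq_nat_card, Nat.card_coe_set_eq] using card_le_of_injective R φ hφ

end LinearAlgebra

section PureTensor

variable {ι κ R R₁ : Type*} [Fintype ι] [CommSemiring R] [CommSemiring R₁]

/-- The pure tensor `⨂ᵢ uᵢ` of a family of vectors in `κ → R`, written in coordinates indexed by
`ι → κ`. -/
def pureTensor (u : ι → κ → R) : (ι → κ) → R := fun y => ∏ i, u i (y i)

theorem pureTensor_dotProduct_pureTensor [Fintype κ] [DecidableEq ι] (u v : ι → κ → R) :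
    pureTensor u ⬝ᵥ pureTensor v = ∏ i, u i ⬝ᵥ v i := by
  simp only [dotProduct, pureTensor, ← Finset.prod_mul_distrib, Finset.prod_univ_sum,
    Fintype.piFinset_univ]

theorem map_of_pureTensor_eq_one [DecidableEq (ι → κ)] [DecidableEq κ] (f : R →+* R₁)
    {u : (ι → κ) → ι → κ → R} (hu : ∀ x i b, f (u x i b) = if b = x i then 1 else 0) :
    (of fun x => pureTensor (u x)).map f = 1 := by
  ext x y
  simp only [map_apply, of_apply, pureTensor, map_prod, hu, Finset.prod_ite_zero,
    Finset.prod_const_one, one_apply, funext_iff, Finset.mem_univ, true_imp_iff, eq_comm]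

end PureTensor

section Reimer

variable {ι : Type*}

/-- The disjoint occurrence `A □ B` of two arbitrary events on the cube `{0, 1}^ι`: the points `x`
for which some set `I` of coordinates is such that `x` restricted to `I` forces `A` and `x`
restricted to the complement of `I` forces `B`. -/
def cubeDisjointOccurrence (A B : Set (ι → Bool)) : Set (ι → Bool) :=
  {x | ∃ I : Set ι, (∀ y, Set.EqOn y x I → y ∈ A) ∧ ∀ y, Set.EqOn y x Iᶜ → y ∈ B}

open Classical in
/-- The local factors of the vector attached to a point `x` of `A □ B` with coordinate set `I`. On
`I` the factor forces agreement with `x`; off `I` it is the combination of the two basis vectors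
that is orthogonal to `cubeFactor x i` and agrees modulo 2 with the basis vector of `x i`. -/
noncomputable def witnessFactor (I : Set ι) (x : ι → Bool) (i : ι) (b : Bool) : ℤ :=
  if i ∈ I then if b = x i then 1 else 0 else if b = x i then -3 else 4

/-- The local factors of the vector attached to a point `z` of the cube. The matrix of these vectors
is the identity modulo 3, so all its principal minors are nonzero. -/
def cubeFactor (z : ι → Bool) (i : ι) (b : Bool) : ℤ := if b = z i then 4 else 3

theorem cast_witnessFactor (I : Set ι) (x : ι → Bool) (i : ι) (b : Bool) :
    Int.castRingHom (ZMod 2) (witnessFactor I x i b) = if b = x i then 1 else 0 := by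
  unfold witnessFactor
  split_ifs <;> decide

theorem cast_cubeFactor (z : ι → Bool) (i : ι) (b : Bool) :
    Int.castRingHom (ZMod 3) (cubeFactor z i b) = if b = z i then 1 else 0 := by
  unfold cubeFactor
  split_ifs <;> decide

theorem witnessFactor_dotProduct_cubeFactor {I : Set ι} {x z : ι → Bool} {i : ι} (hi : i ∉ I)
    (hz : z i = x i) : witnessFactor I x i ⬝ᵥ cubeFactor z i = 0 := by
  cases hx : x i <;> simp [dotProduct, witnessFactor, cubeFactor, hi, hz, hx]

/-- Reimer's theorem. The vectors attached to the points of `A □ B` are independent, vanish off `A`,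
and are orthogonal to the vector of `z` unless `zᶜ ∈ B`. -/
theorem ncard_cubeDisjointOccurrence_le [Finite ι] (A B : Set (ι → Bool)) :
    (cubeDisjointOccurrence A B).ncard ≤ (A ∩ compl ⁻¹' B).ncard := by
  classical
  have := Fintype.ofFinite ι
  have hex : ∀ x ∈ cubeDisjointOccurrence A B, ∃ I : Set ι,
      (∀ y, Set.EqOn y x I → y ∈ A) ∧ ∀ y, Set.EqOn y x Iᶜ → y ∈ B := fun _ hx => hx
  choose! I hI using hex
  let W : Matrix (ι → Bool) (ι → Bool) ℤ := of fun x => pureTensor (witnessFactor (I x) x)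
  let P : Matrix (ι → Bool) (ι → Bool) ℤ := of fun z => pureTensor (cubeFactor z)
  refine ncard_le_ncard_inter_of_map_eq_one (Int.castRingHom (ZMod 2)) (Int.castRingHom (ZMod 3))
    (W := W) (P := Pᵀ) (map_of_pureTensor_eq_one _ fun x => cast_witnessFactor (I x) x)
    ?_ (fun x hx y hy => ?_) fun x hx z hz => ?_
  · rw [transpose_map, map_of_pureTensor_eq_one _ cast_cubeFactor, transpose_one]
  · obtain ⟨i, hi, hne⟩ : ∃ i ∈ I x, y i ≠ x i := by
      by_contra! h
      exact hy ((hI x hx).1 y h)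
    exact Finset.prod_eq_zero (Finset.mem_univ i) (by simp [witnessFactor, hi, hne])
  · obtain ⟨i, hi, heq⟩ : ∃ i ∉ I x, z i = x i := by
      by_contra! h
      exact hz ((hI x hx).2 zᶜ fun i hi => Bool.not_eq.mpr (h i hi))
    calc (W * Pᵀ) x z = ∏ i, witnessFactor (I x) x i ⬝ᵥ cubeFactor z i :=
          pureTensor_dotProduct_pureTensor _ _
      _ = 0 := Finset.prod_eq_zero (Finset.mem_univ i)
          (witnessFactor_dotProduct_cubeFactor hi heq)

end Reimer

section Choice

variable {ι V : Type*}

/-- The set that agrees with `D` on the fibres of `r` selected by `x` and with `C` on the other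
fibres. -/
def fiberwiseChoice (r : V → ι) (C D : Set V) (x : ι → Bool) : Set V :=
  {v | x (r v) = true}.ite D C

variable {r : V → ι} {C D E : Set V} {x y : ι → Bool}

theorem mem_fiberwiseChoice {v : V} :
    v ∈ fiberwiseChoice r C D x ↔ if x (r v) = true then v ∈ D else v ∈ C := by
  by_cases h : x (r v) = true <;> simp [fiberwiseChoice, Set.ite, h]

theorem injOn_fiberwiseChoice (hCD : (C \ D).InjOn r) (hDC : (D \ C).InjOn r) :
    (fiberwiseChoice r C D x \ (C ∩ D)).InjOn r := by
  rintro u ⟨hu, huK⟩ v ⟨hv, hvK⟩ huv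
  rw [mem_fiberwiseChoice] at hu hv
  rw [huv] at hu
  split_ifs at hu hv
  · exact hDC ⟨hu, fun h => huK ⟨h, hu⟩⟩ ⟨hv, fun h => hvK ⟨h, hv⟩⟩ huv
  · exact hCD ⟨hu, fun h => huK ⟨hu, h⟩⟩ ⟨hv, fun h => hvK ⟨hv, h⟩⟩ huv

theorem subset_fiberwiseChoice_of_eqOn (hE : E ⊆ fiberwiseChoice r C D x)
    (hxy : Set.EqOn y x (r '' (E \ (C ∩ D)))) : E ⊆ fiberwiseChoice r C D y := by
  intro v hv
  rw [mem_fiberwiseChoice]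
  by_cases hvK : v ∈ C ∩ D
  · split_ifs
    exacts [hvK.2, hvK.1]
  · rw [hxy ⟨v, ⟨hv, hvK⟩, rfl⟩, ← mem_fiberwiseChoice]
    exact hE hv

theorem mem_cubeDisjointOccurrence_of_mem_disjointOccurrence (hCD : (C \ D).InjOn r)
    (hDC : (D \ C).InjOn r) {𝒜 ℬ : Set (Set V)} (h𝒜 : IsUpperSet 𝒜) (hℬ : IsUpperSet ℬ)
    (hx : fiberwiseChoice r C D x ∈ disjointOccurrence 𝒜 ℬ) :
    x ∈ cubeDisjointOccurrence (fiberwiseChoice r C D ⁻¹' 𝒜) (fiberwiseChoice r C D ⁻¹' ℬ) := by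
  obtain ⟨A, hA, B, hB, hAB, hx⟩ := hx
  have hAx : A ⊆ fiberwiseChoice r C D x := hx ▸ Set.subset_union_left
  have hBx : B ⊆ fiberwiseChoice r C D x := hx ▸ Set.subset_union_right
  have hdisj : r '' (B \ (C ∩ D)) ⊆ (r '' (A \ (C ∩ D)))ᶜ := by
    rintro _ ⟨v, ⟨hv, hvK⟩, rfl⟩ ⟨u, ⟨hu, huK⟩, huv⟩
    obtain rfl := injOn_fiberwiseChoice hCD hDC ⟨hAx hu, huK⟩ ⟨hBx hv, hvK⟩ huv
    exact Set.eq_empty_iff_forall_notMem.mp hAB u ⟨hu, hv⟩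
  exact ⟨r '' (A \ (C ∩ D)), fun y hy => h𝒜 (subset_fiberwiseChoice_of_eqOn hAx hy) hA,
    fun y hy => hℬ (subset_fiberwiseChoice_of_eqOn hBx (hy.mono hdisj)) hB⟩

theorem ncard_fiberwiseChoice_mem_disjointOccurrence_le [Finite ι] (hCD : (C \ D).InjOn r)
    (hDC : (D \ C).InjOn r) {𝒜 ℬ : Set (Set V)} (h𝒜 : IsUpperSet 𝒜) (hℬ : IsUpperSet ℬ) :
    {x | fiberwiseChoice r C D x ∈ disjointOccurrence 𝒜 ℬ}.ncard ≤
      {x | fiberwiseChoice r C D x ∈ 𝒜 ∧ fiberwiseChoice r C D xᶜ ∈ ℬ}.ncard :=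
  (Set.ncard_le_ncard fun _ hx =>
      mem_cubeDisjointOccurrence_of_mem_disjointOccurrence hCD hDC h𝒜 hℬ hx).trans
    (ncard_cubeDisjointOccurrence_le _ _)

end Choice

section Alternating

theorem reflTransGen_of_reflTransGen_symmGen {α : Type*} {r : α → α → Prop}
    (hr : Relator.LeftUnique r) {u v : α} (hu : ∀ a, ¬ r a u)
    (h : Relation.ReflTransGen (Relation.SymmGen r) u v) : Relation.ReflTransGen r u v := by
  induction h with
  | refl => exact .refl
  | tail _ hbc ih =>
    rcases hbc with hbc | hcb
    · exact ih.tail hbc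
    · rcases ih.cases_tail with rfl | ⟨d, hud, hdb⟩
      · exact (hu _ hcb).elim
      · exact hr hdb hcb ▸ hud

variable {V : Type*} {G : SimpleGraph V} {S T : Set V}

theorem mem_iff_notMem_of_adj (hG : G.IsBipartiteWith S T) {a b : V} (hab : G.Adj a b) :
    a ∈ S ↔ b ∉ S := by
  have hdisj {v : V} : v ∈ S → v ∉ T := fun hv => Set.disjoint_left.mp hG.disjoint hv
  have := hG.mem_of_adj hab
  grind

/-- The arcs obtained by directing the edges of `M` into `S` and those of `N` out of `S`. -/
def alternatingArc (S : Set V) (M N : Matching G) (a b : V) : Prop :=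
  a ∉ S ∧ M.1.Adj a b ∨ a ∈ S ∧ N.1.Adj a b

theorem leftUnique_alternatingArc (hG : G.IsBipartiteWith S T) (M N : Matching G) :
    Relator.LeftUnique (alternatingArc S M N) := by
  rintro a b c (⟨ha, hac⟩ | ⟨ha, hac⟩) (⟨hb, hbc⟩ | ⟨hb, hbc⟩)
  · exact M.2.eq_of_adj_right hac hbc
  · exact (ha ((mem_iff_notMem_of_adj hG hac.adj_sub).mpr
      ((mem_iff_notMem_of_adj hG hbc.adj_sub).mp hb))).elim
  · exact (hb ((mem_iff_notMem_of_adj hG hbc.adj_sub).mpr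
      ((mem_iff_notMem_of_adj hG hac.adj_sub).mp ha))).elim
  · exact N.2.eq_of_adj_right hac hbc

theorem not_alternatingArc_of_mem_sdiff (hG : G.IsBipartiteWith S T) {M N : Matching G} {a b : V}
    (hb : b ∈ coverSymmDiff S M \ coverSymmDiff S N) : ¬ alternatingArc S M N a b := by
  simp only [coverSymmDiff, Set.mem_sdiff, Set.mem_symmDiff] at hb
  rintro (⟨ha, hab⟩ | ⟨ha, hab⟩) <;>
  · have := mem_iff_notMem_of_adj hG hab.adj_sub
    have := hab.snd_mem
    tauto

theorem symmGen_alternatingArc_of_adj (hG : G.IsBipartiteWith S T) {M N : Matching G} {a b : V}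
    (hab : (M.1 ⊔ N.1).Adj a b) : Relation.SymmGen (alternatingArc S M N) a b := by
  have hS := mem_iff_notMem_of_adj hG hab.adj_sub
  rw [SimpleGraph.Subgraph.sup_adj] at hab
  simp only [Relation.SymmGen, alternatingArc, M.1.adj_comm b, N.1.adj_comm b]
  tauto

theorem eq_of_reachable_of_mem_sdiff (hG : G.IsBipartiteWith S T) {M N : Matching G} {u v : V}
    (hu : u ∈ coverSymmDiff S M \ coverSymmDiff S N)
    (hv : v ∈ coverSymmDiff S M \ coverSymmDiff S N)
    (huv : (M.1 ⊔ N.1).spanningCoe.Reachable u v) : u = v := by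
  have hpath : Relation.ReflTransGen (alternatingArc S M N) u v :=
    reflTransGen_of_reflTransGen_symmGen (leftUnique_alternatingArc hG M N)
      (fun _ => not_alternatingArc_of_mem_sdiff hG hu)
      (Relation.ReflTransGen.mono (fun _ _ => symmGen_alternatingArc_of_adj hG) _ _
        ((SimpleGraph.reachable_iff_reflTransGen u v).mp huv))
  rcases hpath.cases_tail with hvu | ⟨a, -, hav⟩
  · exact hvu.symm
  · exact (not_alternatingArc_of_mem_sdiff hG hv hav).elim

end Alternating

section Splice

variable {V : Type*} {G : SimpleGraph V}

/-- The subgraph that agrees with `M` off `U` and with `N` on `U`; edges between `U` and its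
complement are lost. -/
def splice (M N : G.Subgraph) (U : Set V) : G.Subgraph := M.deleteVerts U ⊔ N.deleteVerts Uᶜ

/-- `U` is a union of connected components of `H`. -/
def Saturated (H : SimpleGraph V) (U : Set V) : Prop := ∀ ⦃a b⦄, H.Adj a b → (a ∈ U ↔ b ∈ U)

variable {M N : G.Subgraph} {U : Set V}

theorem splice_verts : (splice M N U).verts = U.ite N.verts M.verts := by
  ext v
  simp [splice, Set.ite, or_comm]

theorem splice_adj {a b : V} :
    (splice M N U).Adj a b ↔ a ∉ U ∧ b ∉ U ∧ M.Adj a b ∨ a ∈ U ∧ b ∈ U ∧ N.Adj a b := by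
  have hM : M.Adj a b → a ∈ M.verts ∧ b ∈ M.verts := fun h => ⟨h.fst_mem, h.snd_mem⟩
  have hN : N.Adj a b → a ∈ N.verts ∧ b ∈ N.verts := fun h => ⟨h.fst_mem, h.snd_mem⟩
  simp only [splice, SimpleGraph.Subgraph.sup_adj, SimpleGraph.Subgraph.deleteVerts_adj,
    Set.mem_compl_iff]
  tauto

theorem splice_compl : splice M N Uᶜ = splice N M U := by
  rw [splice, splice, compl_compl, sup_comm]

namespace Saturated

theorem sup_comm (hU : Saturated (M ⊔ N).spanningCoe U) : Saturated (N ⊔ M).spanningCoe U :=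
  _root_.sup_comm M N ▸ hU

theorem isMatching_splice (hU : Saturated (M ⊔ N).spanningCoe U) (hM : M.IsMatching)
    (hN : N.IsMatching) : (splice M N U).IsMatching := by
  intro v hv
  rw [splice_verts] at hv
  have hadj (w : V) : (splice M N U).Adj v w ↔ v ∉ U ∧ M.Adj v w ∨ v ∈ U ∧ N.Adj v w := by
    have := @hU v w
    simp only [SimpleGraph.Subgraph.spanningCoe_adj, SimpleGraph.Subgraph.sup_adj,
      splice_adj] at this ⊢
    tauto
  simp only [hadj]
  rcases hv with ⟨hvN, hvU⟩ | ⟨hvM, hvU⟩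
  · simpa [hvU] using hN hvN
  · simpa [hvU] using hM hvM

theorem splice_sup_splice (hU : Saturated (M ⊔ N).spanningCoe U) :
    splice M N U ⊔ splice N M U = M ⊔ N := by
  ext a b
  · simp only [SimpleGraph.Subgraph.verts_sup, splice_verts, Set.ite, Set.mem_union,
      Set.mem_inter_iff, Set.mem_sdiff]
    tauto
  · have := @hU a b
    simp only [SimpleGraph.Subgraph.spanningCoe_adj, SimpleGraph.Subgraph.sup_adj,
      splice_adj] at this ⊢
    tauto

theorem splice_inf_splice (hU : Saturated (M ⊔ N).spanningCoe U) :
    splice M N U ⊓ splice N M U = M ⊓ N := by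
  ext a b
  · simp only [SimpleGraph.Subgraph.verts_inf, splice_verts, Set.ite, Set.mem_union,
      Set.mem_inter_iff, Set.mem_sdiff]
    tauto
  · have := @hU a b
    simp only [SimpleGraph.Subgraph.spanningCoe_adj, SimpleGraph.Subgraph.sup_adj,
      SimpleGraph.Subgraph.inf_adj, splice_adj] at this ⊢
    tauto

theorem splice_splice (hU : Saturated (M ⊔ N).spanningCoe U) :
    splice (splice M N U) (splice N M U) U = M := by
  ext a b
  · simp only [splice_verts, Set.ite, Set.mem_union, Set.mem_inter_iff, Set.mem_sdiff]
    tauto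
  · have := @hU a b
    simp only [SimpleGraph.Subgraph.spanningCoe_adj, SimpleGraph.Subgraph.sup_adj,
      splice_adj] at this ⊢
    tauto

end Saturated

theorem coverSymmDiff_eq_ite_of_verts_eq {S : Set V} {L M N : Matching G}
    (hL : L.1.verts = U.ite N.1.verts M.1.verts) :
    coverSymmDiff S L = U.ite (coverSymmDiff S N) (coverSymmDiff S M) := by
  ext v
  simp only [coverSymmDiff, hL, Set.ite, Set.mem_symmDiff, Set.mem_union, Set.mem_inter_iff,
    Set.mem_sdiff]
  tauto

end Splice

section Swap

variable {V : Type*} {G : SimpleGraph V}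

/-- A vertex chosen in the connected component of `v`. Indexing components by vertices lets the
single cube `V → Bool` act on all pairs of matchings at once. -/
noncomputable def componentRep (H : SimpleGraph V) (v : V) : V := (H.connectedComponentMk v).out

theorem componentRep_eq_iff {H : SimpleGraph V} {a b : V} :
    componentRep H a = componentRep H b ↔ H.Reachable a b := by
  rw [← SimpleGraph.ConnectedComponent.eq]
  exact (Function.LeftInverse.injective (g := Quot.mk _) Quot.out_eq).eq_iff

/-- The union of the connected components of `H` whose chosen vertex is selected by `x`. -/
def selectedComponents (H : SimpleGraph V) (x : V → Bool) : Set V :=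
  {v | x (componentRep H v) = true}

theorem selectedComponents_compl (H : SimpleGraph V) (x : V → Bool) :
    selectedComponents H xᶜ = (selectedComponents H x)ᶜ := by
  ext v
  simp [selectedComponents]

theorem saturated_selectedComponents (H : SimpleGraph V) (x : V → Bool) :
    Saturated H (selectedComponents H x) := fun a b hab => by
  simp only [selectedComponents, Set.mem_ofPred_eq, componentRep_eq_iff.mpr hab.reachable]

/-- The exchange of two matchings on the components of their union selected by `x`. -/
def swap (x : V → Bool) (p : Matching G × Matching G) : Matching G × Matching G :=
  let U := selectedComponents (p.1.1 ⊔ p.2.1).spanningCoe x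
  have hU : Saturated (p.1.1 ⊔ p.2.1).spanningCoe U := saturated_selectedComponents _ x
  (⟨splice p.1.1 p.2.1 U, hU.isMatching_splice p.1.2 p.2.2⟩,
   ⟨splice p.2.1 p.1.1 U, hU.sup_comm.isMatching_splice p.2.2 p.1.2⟩)

theorem swap_involutive (x : V → Bool) : Function.Involutive (swap (G := G) x) := by
  rintro ⟨M, N⟩
  have hU := saturated_selectedComponents (M.1 ⊔ N.1).spanningCoe x
  refine Prod.ext (Subtype.ext ?_) (Subtype.ext ?_)
  · simp only [swap, hU.splice_sup_splice, hU.splice_splice]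
  · simp only [swap, hU.splice_sup_splice, hU.sup_comm.splice_splice]

theorem swap_compl_fst (x : V → Bool) (p : Matching G × Matching G) :
    (swap xᶜ p).1 = (swap x p).2 := by
  apply Subtype.ext
  simp only [swap, selectedComponents_compl, splice_compl]

theorem coverSymmDiff_swap_fst (S : Set V) (x : V → Bool) (p : Matching G × Matching G) :
    coverSymmDiff S (swap x p).1 =
      fiberwiseChoice (componentRep (p.1.1 ⊔ p.2.1).spanningCoe)
        (coverSymmDiff S p.1) (coverSymmDiff S p.2) x :=
  coverSymmDiff_eq_ite_of_verts_eq splice_verts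

theorem coverSymmDiff_swap_snd (S : Set V) (x : V → Bool) (p : Matching G × Matching G) :
    coverSymmDiff S (swap x p).2 =
      fiberwiseChoice (componentRep (p.1.1 ⊔ p.2.1).spanningCoe)
        (coverSymmDiff S p.1) (coverSymmDiff S p.2) xᶜ := by
  rw [← swap_compl_fst, coverSymmDiff_swap_fst]

theorem injOn_componentRep_sdiff {S T : Set V} (hG : G.IsBipartiteWith S T) (M N : Matching G) :
    (coverSymmDiff S M \ coverSymmDiff S N).InjOn (componentRep (M.1 ⊔ N.1).spanningCoe) :=
  fun _ hu _ hv huv => eq_of_reachable_of_mem_sdiff hG hu hv (componentRep_eq_iff.mp huv)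

theorem ncard_swap_mem_disjointOccurrence_le [Finite V] {S T : Set V} (hG : G.IsBipartiteWith S T)
    {𝒜 ℬ : Set (Set V)} (h𝒜 : IsUpperSet 𝒜) (hℬ : IsUpperSet ℬ) (p : Matching G × Matching G) :
    {x | coverSymmDiff S (swap x p).1 ∈ disjointOccurrence 𝒜 ℬ}.ncard ≤
      {x | coverSymmDiff S (swap x p).1 ∈ 𝒜 ∧ coverSymmDiff S (swap x p).2 ∈ ℬ}.ncard := by
  simp only [coverSymmDiff_swap_fst, coverSymmDiff_swap_snd]
  refine ncard_fiberwiseChoice_mem_disjointOccurrence_le (injOn_componentRep_sdiff hG _ _) ?_ h𝒜 hℬ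
  rw [sup_comm]
  exact injOn_componentRep_sdiff hG _ _

end Swap

section Weight

variable {V : Type*} [Finite V] {G : SimpleGraph V} {w : Sym2 V → ℝ}

theorem weight_eq_finprod_mem (w : Sym2 V → ℝ) (M : Matching G) :
    weight w M = ∏ᶠ e ∈ M.1.edgeSet, w e :=
  (finprod_mem_eq_finite_toFinset_prod w _).symm

theorem weight_swap (w : Sym2 V → ℝ) (x : V → Bool) (p : Matching G × Matching G) :
    weight w (swap x p).1 * weight w (swap x p).2 = weight w p.1 * weight w p.2 := by
  have hU := saturated_selectedComponents (p.1.1 ⊔ p.2.1).spanningCoe x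
  simp only [weight_eq_finprod_mem]
  rw [← finprod_mem_union_inter (Set.toFinite _) (Set.toFinite _),
    ← finprod_mem_union_inter (Set.toFinite p.1.1.edgeSet) (Set.toFinite _)]
  simp only [← SimpleGraph.Subgraph.edgeSet_sup, ← SimpleGraph.Subgraph.edgeSet_inf, swap,
    hU.splice_sup_splice, hU.splice_inf_splice]

theorem weight_nonneg (hw : ∀ e ∈ G.edgeSet, 0 ≤ w e) (M : Matching G) : 0 ≤ weight w M :=
  Finset.prod_nonneg fun e he => hw e (M.1.edgeSet_subset ((Set.Finite.mem_toFinset _).mp he))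

theorem randomMatching_swap (hw : ∀ e ∈ G.edgeSet, 0 ≤ w e) (x : V → Bool)
    (p : Matching G × Matching G) :
    randomMatching G w (swap x p).1 * randomMatching G w (swap x p).2 =
      randomMatching G w p.1 * randomMatching G w p.2 := by
  simp only [randomMatching, PMF.normalize_apply]
  rw [mul_mul_mul_comm, mul_mul_mul_comm (ENNReal.ofReal (weight w p.1)),
    ← ENNReal.ofReal_mul (weight_nonneg hw _), ← ENNReal.ofReal_mul (weight_nonneg hw _),
    weight_swap]

end Weight

section Measure

theorem natCard_mul_measure_eq_lintegral_ncard {Ω X : Type*} [MeasurableSpace Ω] [Finite X]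
    {μ : Measure Ω} {σ : X → Ω → Ω} (hσ : ∀ x, MeasurePreserving (σ x) μ μ) {E : Set Ω}
    (hE : MeasurableSet E) :
    (Nat.card X : ENNReal) * μ E = ∫⁻ p, ({x | σ x p ∈ E}.ncard : ENNReal) ∂μ := by
  classical
  have := Fintype.ofFinite X
  calc (Nat.card X : ENNReal) * μ E = ∑ x, μ (σ x ⁻¹' E) := by
        simp [(hσ _).measure_preimage hE.nullMeasurableSet]
    _ = ∑ x, ∫⁻ p, (σ x ⁻¹' E).indicator 1 p ∂μ := by
        simp only [lintegral_indicator_one ((hσ _).measurable hE)]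
    _ = ∫⁻ p, ∑ x, (σ x ⁻¹' E).indicator 1 p ∂μ :=
        (lintegral_finsetSum _ fun x _ =>
          measurable_one.indicator ((hσ x).measurable hE)).symm
    _ = ∫⁻ p, ({x | σ x p ∈ E}.ncard : ENNReal) ∂μ := by
        simp [Set.indicator_apply, Set.ncard_eq_toFinset_card']

theorem measure_le_measure_of_ncard_le {Ω X : Type*} [MeasurableSpace Ω] [Finite X] [Nonempty X]
    {μ : Measure Ω} {σ : X → Ω → Ω} (hσ : ∀ x, MeasurePreserving (σ x) μ μ) {E F : Set Ω}
    (hE : MeasurableSet E) (hF : MeasurableSet F)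
    (h : ∀ p, {x | σ x p ∈ E}.ncard ≤ {x | σ x p ∈ F}.ncard) : μ E ≤ μ F := by
  have hX : (Nat.card X : ENNReal) ≠ 0 := Nat.cast_ne_zero.mpr Nat.card_pos.ne'
  refine (ENNReal.mul_le_mul_iff_right hX (ENNReal.natCast_ne_top _)).mp ?_
  rw [natCard_mul_measure_eq_lintegral_ncard hσ hE, natCard_mul_measure_eq_lintegral_ncard hσ hF]
  exact lintegral_mono fun p => Nat.cast_le.mpr (h p)

variable {V : Type*} [Finite V] {G : SimpleGraph V} {w : Sym2 V → ℝ}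
  [MeasurableSpace (Matching G)] [DiscreteMeasurableSpace (Matching G)]

theorem prob_randomSet (S : Set V) (w : Sym2 V → ℝ) (𝒜 : Set (Set V)) :
    prob (randomSet G S w) 𝒜 = (randomMatching G w).toMeasure (coverSymmDiff S ⁻¹' 𝒜) :=
  @PMF.toMeasure_map_apply _ _ _ _ _ _ ⊤ (fun _ _ => .of_discrete) trivial

theorem measurePreserving_swap (hw : ∀ e ∈ G.edgeSet, 0 ≤ w e) (x : V → Bool) :
    MeasurePreserving (swap x) ((randomMatching G w).toMeasure.prod (randomMatching G w).toMeasure)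
      ((randomMatching G w).toMeasure.prod (randomMatching G w).toMeasure) := by
  refine ⟨.of_discrete, Measure.ext_of_singleton fun p => ?_⟩
  have hpre : swap x ⁻¹' {p} = {swap x p} := by
    ext q
    exact (swap_involutive x).eq_iff
  have hsingleton (q : Matching G × Matching G) :
      ((randomMatching G w).toMeasure.prod (randomMatching G w).toMeasure) {q} =
        randomMatching G w q.1 * randomMatching G w q.2 := by
    rw [← Prod.mk.eta (p := q), ← Set.singleton_prod_singleton, Measure.prod_prod,
      PMF.toMeasure_apply_singleton _ _ .of_discrete,
      PMF.toMeasure_apply_singleton _ _ .of_discrete]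
  rw [Measure.map_apply .of_discrete (.singleton p), hpre, hsingleton, hsingleton,
    randomMatching_swap hw x p]

end Measure

end BKMatching

theorem theorem2 {V : Type*} [Finite V] (G : SimpleGraph V) (S T : Set V)
    (hST : S ∪ T = Set.univ) (hG : G.IsBipartiteWith S T)
    (w : Sym2 V → ℝ) (hw : ∀ e ∈ G.edgeSet, 0 < w e)
    (𝒜 ℬ : Set (Set V)) (h𝒜 : IsUpperSet 𝒜) (hℬ : IsUpperSet ℬ) :
    BKMatching.prob (BKMatching.randomSet G S w) (BKMatching.disjointOccurrence 𝒜 ℬ) ≤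
      BKMatching.prob (BKMatching.randomSet G S w) 𝒜 *
        BKMatching.prob (BKMatching.randomSet G S w) ℬ := by
  let _ : MeasurableSpace (BKMatching.Matching G) := ⊤
  let μ := (BKMatching.randomMatching G w).toMeasure
  simp only [BKMatching.prob_randomSet]
  calc μ (BKMatching.coverSymmDiff S ⁻¹' BKMatching.disjointOccurrence 𝒜 ℬ)
    _ = (μ.prod μ)
          ((BKMatching.coverSymmDiff S ⁻¹' BKMatching.disjointOccurrence 𝒜 ℬ) ×ˢ Set.univ) := by
      rw [MeasureTheory.Measure.prod_prod, MeasureTheory.measure_univ, mul_one]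
    _ ≤ (μ.prod μ) ((BKMatching.coverSymmDiff S ⁻¹' 𝒜) ×ˢ (BKMatching.coverSymmDiff S ⁻¹' ℬ)) :=
      BKMatching.measure_le_measure_of_ncard_le
        (BKMatching.measurePreserving_swap fun e he => (hw e he).le) .of_discrete .of_discrete
        fun p => by simpa using BKMatching.ncard_swap_mem_disjointOccurrence_le hG h𝒜 hℬ p
    _ = μ (BKMatching.coverSymmDiff S ⁻¹' 𝒜) * μ (BKMatching.coverSymmDiff S ⁻¹' ℬ) :=
      MeasureTheory.Measure.prod_prod _ _
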